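/- Let $\omega$ be a symplectic form on $\mathbb{R}^4$ (a nondegenerate alternating bilinear form), written $\omega(x,y)=x^T\Omega y$ with $\Omega$ skew-symmetric and invertible, and let $H$ be a quadratic form on $\mathbb{R}^4$, written $H(x)=x^TSx$ with $S$ symmetric. Assume that $S$ is invertible and that $H$ has signature $0$, i.e. as many positive as negative squares. Let $L=\Omega^{-1}S$ be the matrix of the linear Hamiltonian system $\dot x=Lx$. The eigenvalues of $L$ are its complex eigenvalues, counted with algebraic multiplicity; the system is called elliptic if all of them are purely imaginary, and hyperbolic if none of them is purely imaginary. The nilpotent part of $L$ is the nilpotent summand $N$ in the Jordan–Chevalley decomposition $L=L_s+N$ (with $L_s$ semisimple, $N$ nilpotent, $L_sN=NL_s$). A Lagrangian plane is a two-dimensional linear subspace of $\mathbb{R}^4$ on which $\omega$ vanishes identically, and $\mathcal{N}=H^{-1}(0)$ is the null-cone of $H$. Then: 1. if the system is elliptic and all eigenvalues of $L$ are simple, then $\mathcal{N}$ contains no Lagrangian plane; 2. if the system is elliptic, all eigenvalues of $L$ have algebraic multiplicity two and the nilpotent part of $L$ is nonzero, then $\mathcal{N}$ contains precisely $1$ Lagrangian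 plane; 3. if the system is hyperbolic and the eigenvalues of $L$ form a complex quadruplet $\kappa\pm i\nu$, $-\kappa\pm i\nu$ with $\kappa,\nu\in\mathbb{R}\setminus\{0\}$, then $\mathcal{N}$ contains precisely $2$ Lagrangian planes; 4. if the system is hyperbolic, all eigenvalues of $L$ are real and have algebraic multiplicity two, and the nilpotent part of $L$ is nonzero, then $\mathcal{N}$ contains precisely $3$ Lagrangian planes; 5. if the system is hyperbolic and all eigenvalues of $L$ are real and simple, then $\mathcal{N}$ contains precisely $4$ Lagrangian planes. -/

import Mathlib

namespace LinHam

noncomputable section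

/-- The matrix `L = Ω⁻¹ S` of the linear system `ẋ = L x`, where `ω(x, y) = xᵀ Ω y` and
`H(x) = xᵀ S x` with `S` symmetric. -/
def systemMatrix (ω : LinearMap.BilinForm ℝ (Fin 4 → ℝ)) (H : QuadraticForm ℝ (Fin 4 → ℝ)) :
    Matrix (Fin 4) (Fin 4) ℝ :=
  (LinearMap.toMatrix₂' ℝ ω)⁻¹ * H.toMatrix'

/-- The complex eigenvalues of a real `4 × 4` matrix, with algebraic multiplicity. -/
def eigenvalues (L : Matrix (Fin 4) (Fin 4) ℝ) : Multiset ℂ :=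
  (L.map (algebraMap ℝ ℂ)).charpoly.roots

/-- All eigenvalues are purely imaginary. -/
def IsElliptic (L : Matrix (Fin 4) (Fin 4) ℝ) : Prop :=
  ∀ μ ∈ eigenvalues L, μ.re = 0

/-- No eigenvalue is purely imaginary. -/
def IsHyperbolic (L : Matrix (Fin 4) (Fin 4) ℝ) : Prop :=
  ∀ μ ∈ eigenvalues L, μ.re ≠ 0

/-- All eigenvalues are real. -/
def HasRealEigenvalues (L : Matrix (Fin 4) (Fin 4) ℝ) : Prop :=
  ∀ μ ∈ eigenvalues L, μ.im = 0

/-- All eigenvalues have algebraic multiplicity one. -/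
def HasSimpleEigenvalues (L : Matrix (Fin 4) (Fin 4) ℝ) : Prop :=
  (eigenvalues L).Nodup

/-- All eigenvalues have algebraic multiplicity two. -/
def HasDoubleEigenvalues (L : Matrix (Fin 4) (Fin 4) ℝ) : Prop :=
  ∀ μ ∈ eigenvalues L, (eigenvalues L).count μ = 2

/-- The eigenvalues are `κ ± iν`, `-κ ± iν` with `κ` and `ν` nonzero reals. -/
def HasComplexQuadruplet (L : Matrix (Fin 4) (Fin 4) ℝ) : Prop :=
  ∃ κ ν : ℝ, κ ≠ 0 ∧ ν ≠ 0 ∧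
    eigenvalues L = {(⟨κ, ν⟩ : ℂ), (⟨κ, -ν⟩ : ℂ), (⟨-κ, ν⟩ : ℂ), (⟨-κ, -ν⟩ : ℂ)}

/-- The nilpotent part in the Jordan–Chevalley decomposition of `L` (the sum of commuting
semisimple and nilpotent endomorphisms, which exists and is unique over `ℝ`) is nonzero. -/
def HasNonzeroNilpotentPart (L : Matrix (Fin 4) (Fin 4) ℝ) : Prop :=
  ∃ s n : Module.End ℝ (Fin 4 → ℝ), s.IsSemisimple ∧ IsNilpotent n ∧ Commute s n ∧
    Matrix.toLin' L = s + n ∧ n ≠ 0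

/-- The null-cone `H⁻¹(0)`. -/
def nullCone (H : QuadraticForm ℝ (Fin 4 → ℝ)) : Set (Fin 4 → ℝ) :=
  {x | H x = 0}

/-- A Lagrangian plane of a symplectic form on `ℝ⁴`: a two-dimensional subspace on which the
form vanishes. -/
def IsLagrangianPlane (ω : LinearMap.BilinForm ℝ (Fin 4 → ℝ))
    (P : Submodule ℝ (Fin 4 → ℝ)) : Prop :=
  Module.finrank ℝ P = 2 ∧ ∀ x ∈ P, ∀ y ∈ P, ω x y = 0

/-- The set of Lagrangian planes contained in the null-cone of `H`. -/
def lagrangianPlanesInNullCone (ω : LinearMap.BilinForm ℝ (Fin 4 → ℝ))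
    (H : QuadraticForm ℝ (Fin 4 → ℝ)) : Set (Submodule ℝ (Fin 4 → ℝ)) :=
  {P | IsLagrangianPlane ω P ∧ (P : Set (Fin 4 → ℝ)) ⊆ nullCone H}

end

end LinHam

/-! Since `ω x (L y)` is the polar form of `H`, the matrix `L` is skew for `ω`, and by polarization
`H` vanishes on a Lagrangian plane `P` exactly when `ω (L x) y = 0` on `P`. As `P` is its own
orthogonal, this says that `L` maps `P` into itself. So the task is to count the `L`-invariant
Lagrangian planes (`lagrangianPlanesInNullCone_eq`).

Skewness also makes the characteristic polynomial even, with roots `μ, -μ, ν, -ν`. Write it as `q(X)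
q(-X)` with `q` quadratic. Taking adjoints exchanges `q(L)` and `q(-L)`, so if their kernels are
disjoint both are Lagrangian (`ker_lagrangian_of_adjoint`). This produces planes in the hyperbolic
cases; when `L² - s` is nonzero with square zero, `ker (L² - s)` is another candidate, and the only
one in the elliptic double case.

Nothing else occurs: a factor of the annihilating polynomial kills a nonzero vector `v` of any
invariant plane. If the factor has no real root, `v` and `L v` span the plane; otherwise real
eigenvectors are extracted, and either two of them span the plane or a factor kills it entirely. -/

open Module

namespace LinHam

/-! ### Invariant planes and quadratic factors of a skew endomorphism -/

variable {V : Type*} [AddCommGroup V] [Module ℝ V]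

/-- The planes that are invariant under `f` and on which `ω` vanishes. -/
def invariantLagrangianPlanes (ω : LinearMap.BilinForm ℝ V) (f : End ℝ V) :
    Set (Submodule ℝ V) :=
  {P | finrank ℝ P = 2 ∧ (∀ x ∈ P, ∀ y ∈ P, ω x y = 0) ∧ ∀ x ∈ P, f x ∈ P}

theorem eq_of_linearIndependent_pair_of_mem {P Q : Submodule ℝ V} (hP : finrank ℝ P = 2)
    (hQ : finrank ℝ Q = 2) {v w : V} (hvw : LinearIndependent ℝ ![v, w])
    (hvP : v ∈ P) (hwP : w ∈ P) (hvQ : v ∈ Q) (hwQ : w ∈ Q) : P = Q := by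
  have hspan := finrank_span_eq_card hvw
  have key : ∀ R : Submodule ℝ V, finrank ℝ R = 2 → v ∈ R → w ∈ R →
      Submodule.span ℝ (Set.range ![v, w]) = R := by
    intro R hR hv hw
    have : FiniteDimensional ℝ R := FiniteDimensional.of_finrank_pos (by omega)
    refine Submodule.eq_of_le_of_finrank_eq ?_ (by rw [hspan, hR]; rfl)
    rw [Submodule.span_le]
    rintro _ ⟨i, rfl⟩
    fin_cases i
    · exact hv
    · exact hw
  rw [← key P hP hvP hwP, key Q hQ hvQ hwQ]

/-- A relation `f v = r • v` would make `r` a real root of a quadratic with negative discriminant.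
Hence `v` and `f v` span any invariant plane containing `v`. -/
theorem linearIndependent_apply_of_sq_neg {f : End ℝ V} {b c : ℝ} (h : b ^ 2 < 4 * c) {v : V}
    (hv : v ≠ 0) (hfv : f (f v) + b • f v + c • v = 0) : LinearIndependent ℝ ![v, f v] := by
  rw [LinearIndependent.pair_iff' hv]
  intro r hr
  have h1 : (r ^ 2 + b * r + c) • v = 0 := by
    rw [← hfv, ← hr, map_smul, ← hr]
    module
  rcases smul_eq_zero.1 h1 with h2 | h2
  · nlinarith [sq_nonneg (2 * r + b)]
  · exact hv h2

variable {ω : LinearMap.BilinForm ℝ V} {f : End ℝ V}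

theorem adjoint_sq (hf : ∀ x y, ω (f x) y = -ω x (f y)) (x y : V) :
    ω (f (f x)) y = ω x (f (f y)) := by
  rw [hf, hf, neg_neg]

/-- Any nonzero `B x` with `x ∈ P` is killed by `A`. The uniqueness arguments use this to find,
inside an invariant plane, a vector annihilated by a chosen factor. -/
theorem exists_mem_ker_or_le_ker {P : Submodule ℝ V} {A B : End ℝ V} (hB : ∀ x ∈ P, B x ∈ P)
    (hAB : A * B = 0) : (∃ v ∈ P, v ≠ 0 ∧ A v = 0) ∨ ∀ x ∈ P, B x = 0 := by
  by_cases h : ∀ x ∈ P, B x = 0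
  · exact Or.inr h
  · push Not at h
    obtain ⟨x, hx, hx0⟩ := h
    exact Or.inl ⟨B x, hB x hx, hx0, LinearMap.congr_fun hAB x⟩

theorem exists_ne_zero_mem_of_finrank_eq_two {P : Submodule ℝ V} (h : finrank ℝ P = 2) :
    ∃ v ∈ P, v ≠ 0 := by
  refine P.ne_bot_iff.1 ?_
  rintro rfl
  simp at h

theorem mem_ker_quadratic {c m : ℝ} {x : V} :
    x ∈ LinearMap.ker (f * f + c • f + m • 1) ↔ f (f x) + c • f x + m • x = 0 := by
  simp

theorem disjoint_ker_quadratic {c m : ℝ} (hc : c ≠ 0) (hm : m ≠ 0) :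
    Disjoint (LinearMap.ker (f * f + c • f + m • 1))
      (LinearMap.ker (f * f + (-c) • f + m • 1)) := by
  rw [Submodule.disjoint_def]
  intro x hx hx'
  rw [mem_ker_quadratic] at hx hx'
  have h : (2 * c) • f x = 0 := by
    rw [← sub_self (0 : V)]
    nth_rw 1 [← hx]
    rw [← hx']
    module
  have h0 : f x = 0 := (smul_eq_zero.1 h).resolve_left (by simpa using hc)
  rw [h0] at hx
  simpa [hm] using hx

/-! ### Lagrangian kernels, and the counts zero, one and two -/

variable [FiniteDimensional ℝ V]

theorem finrank_le_two_of_isotropic (hV : finrank ℝ V = 4) (hnd : ω.Nondegenerate)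
    {P : Submodule ℝ V} (hP : ∀ x ∈ P, ∀ y ∈ P, ω x y = 0) : finrank ℝ P ≤ 2 := by
  have h := LinearMap.BilinForm.finrank_orthogonal hnd P
  have hle : P ≤ ω.orthogonal P := fun x hx y hy => hP y hy x hx
  have := Submodule.finrank_mono hle
  omega

/-- A Lagrangian plane lies in its orthogonal, which also has dimension `4 - 2 = 2`, so the two
coincide. -/
theorem mem_of_orthogonal_lagrangian (hV : finrank ℝ V = 4) (hω : ω.IsAlt)
    (hnd : ω.Nondegenerate) {P : Submodule ℝ V} (h2 : finrank ℝ P = 2)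
    (hP : ∀ x ∈ P, ∀ y ∈ P, ω x y = 0) {x : V} (hx : ∀ y ∈ P, ω x y = 0) : x ∈ P := by
  have h := LinearMap.BilinForm.finrank_orthogonal hnd P
  have hle : P ≤ ω.orthogonal P := fun x hx y hy => hP y hy x hx
  have heq : P = ω.orthogonal P := Submodule.eq_of_le_of_finrank_eq hle (by omega)
  rw [heq]
  intro y hy
  exact hω.isRefl _ _ (hx y hy)

/-- The kernels of two mutually adjoint endomorphisms that annihilate each other and have
independent kernels are Lagrangian planes. -/
theorem ker_lagrangian_of_adjoint (hV : finrank ℝ V = 4) (hω : ω.IsAlt)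
    (hnd : ω.Nondegenerate) {T T' : End ℝ V} (hadj : ∀ x y, ω (T x) y = ω x (T' y))
    (h₁ : T * T' = 0) (h₂ : T' * T = 0) (hdis : Disjoint (LinearMap.ker T) (LinearMap.ker T')) :
    finrank ℝ (LinearMap.ker T) = 2 ∧
      ∀ x ∈ LinearMap.ker T, ∀ y ∈ LinearMap.ker T, ω x y = 0 := by
  have hadj' : ∀ x y, ω (T' x) y = ω x (T y) := fun x y => by
    rw [← neg_inj, hω.neg_eq, hω.neg_eq, hadj]
  have key : ∀ A A' : End ℝ V, (∀ x y, ω (A x) y = ω x (A' y)) → A * A' = 0 →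
      Disjoint (LinearMap.ker A) (LinearMap.ker A') →
      4 = finrank ℝ (LinearMap.ker A) + finrank ℝ (LinearMap.ker A') ∧
      ∀ x ∈ LinearMap.ker A, ∀ y ∈ LinearMap.ker A, ω x y = 0 := by
    intro A A' hA hAA hd
    -- Rank–nullity for `A'` and disjointness of the kernels turn this inclusion into an equality.
    -- Then `y = A' z` gives `ω x y = ω (A x) z = 0`.
    have hle : LinearMap.range A' ≤ LinearMap.ker A := by
      rintro _ ⟨x, rfl⟩
      exact LinearMap.congr_fun hAA x
    have hrn := LinearMap.finrank_range_add_finrank_ker A'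
    have hdd := Submodule.finrank_add_finrank_le_of_disjoint hd
    have hm := Submodule.finrank_mono hle
    have heq := Submodule.eq_of_le_of_finrank_eq hle (by omega)
    refine ⟨by rw [← heq]; omega, fun x hx y hy => ?_⟩
    rw [← heq] at hy
    obtain ⟨z, rfl⟩ := hy
    rw [← hA, LinearMap.mem_ker.1 hx]
    simp
  obtain ⟨hsum, hiso⟩ := key T T' hadj h₁ hdis
  obtain ⟨-, hiso'⟩ := key T' T hadj' h₂ hdis.symm
  have := finrank_le_two_of_isotropic hV hnd hiso
  have := finrank_le_two_of_isotropic hV hnd hiso'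
  exact ⟨by omega, hiso⟩

/-- The quadratic factors of `f⁴ + (2m - c²)f² + m²` are interchanged by taking adjoints. -/
theorem ker_quadratic_mem_invariantLagrangianPlanes (hV : finrank ℝ V = 4) (hω : ω.IsAlt)
    (hnd : ω.Nondegenerate) (hf : ∀ x y, ω (f x) y = -ω x (f y)) {c m : ℝ} (hc : c ≠ 0)
    (hm : m ≠ 0)
    (hann : ∀ x, f (f (f (f x))) + (2 * m - c ^ 2) • f (f x) + m ^ 2 • x = 0) :
    LinearMap.ker (f * f + c • f + m • 1) ∈ invariantLagrangianPlanes ω f := by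
  obtain ⟨h1, h2⟩ := ker_lagrangian_of_adjoint (T := f * f + c • f + m • 1)
    (T' := f * f + (-c) • f + m • 1) hV hω hnd
    (by
      intro x y
      simp only [LinearMap.add_apply, LinearMap.smul_apply, Module.End.mul_apply,
        Module.End.one_apply, map_add, map_smul, smul_eq_mul, adjoint_sq hf, hf]
      ring)
    (by
      ext x
      simp only [LinearMap.add_apply, LinearMap.smul_apply, Module.End.mul_apply,
        Module.End.one_apply, map_add, map_smul, LinearMap.zero_apply]
      rw [← hann x]
      module)
    (by
      ext x
      simp only [LinearMap.add_apply, LinearMap.smul_apply, Module.End.mul_apply,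
        Module.End.one_apply, map_add, map_smul, LinearMap.zero_apply]
      rw [← hann x]
      module)
    (disjoint_ker_quadratic hc hm)
  refine ⟨h1, h2, fun x hx => ?_⟩
  rw [LinearMap.mem_ker] at hx ⊢
  rw [← map_zero f, ← hx]
  simp

/-- An invariant Lagrangian plane meets both eigenspaces of `f²`. -/
theorem exists_mem_eigenspace_sq (hV : finrank ℝ V = 4) (hω : ω.IsAlt)
    (hnd : ω.Nondegenerate) (hf : ∀ x y, ω (f x) y = -ω x (f y)) {s t : ℝ} (hst : s ≠ t)
    (hann : ∀ x, f (f (f (f x))) - (s + t) • f (f x) + (s * t) • x = 0)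
    (hns : f * f ≠ s • 1) {P : Submodule ℝ V} (hP : P ∈ invariantLagrangianPlanes ω f) :
    (¬ ∀ x ∈ P, f (f x) = s • x) ∧ ∃ v ∈ P, v ≠ 0 ∧ f (f v) = t • v := by
  obtain ⟨h2, hiso, hinv⟩ := hP
  have hnot : ¬ ∀ x ∈ P, f (f x) = s • x := by
    intro hall
    apply hns
    ext x
    -- `f²` is self-adjoint, so if it equals `s` on `P` then `(f² - s) x` is orthogonal to `P` for
    -- every `x`, hence in `P`. Thus `(f² - s)² = 0`, and subtracting `(f² - s)(f² - t) = 0` leaves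
    -- `f² = s` on all of `V`.
    have hx : f (f x) - s • x ∈ P := by
      refine mem_of_orthogonal_lagrangian hV hω hnd h2 hiso fun y hy => ?_
      rw [map_sub, LinearMap.sub_apply, adjoint_sq hf, hall y hy]
      simp
    have h := hall _ hx
    have hx' := hann x
    have h0 : (s - t) • (f (f x) - s • x) = 0 := by
      rw [← sub_self (0 : V)]
      nth_rw 1 [← hx']
      rw [← sub_eq_zero.2 h]
      simp only [map_sub, map_smul]
      module
    have := (smul_eq_zero.1 h0).resolve_left (sub_ne_zero.2 hst)
    simpa using sub_eq_zero.1 this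
  refine ⟨hnot, ?_⟩
  rcases exists_mem_ker_or_le_ker (P := P) (A := f * f - t • 1) (B := f * f - s • 1)
    (fun x hx => P.sub_mem (hinv _ (hinv _ hx)) (P.smul_mem _ hx))
    (by
      ext x
      rw [LinearMap.zero_apply, ← hann x]
      simp only [LinearMap.sub_apply, LinearMap.smul_apply, Module.End.mul_apply,
        Module.End.one_apply, map_sub, map_smul]
      module) with ⟨v, hv, hv0, h⟩ | h
  · exact ⟨v, hv, hv0, by simpa using sub_eq_zero.1 h⟩
  · exact absurd (fun x hx => by simpa using sub_eq_zero.1 (h x hx)) hnot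

/-- An invariant Lagrangian plane would contain some `v ≠ 0` with `f² v = t v`. As `t < 0`, `v` and
`f v` span it, so `f² = t` on the whole plane, which `exists_mem_eigenspace_sq` forbids. -/
theorem invariantLagrangianPlanes_eq_empty (hV : finrank ℝ V = 4) (hω : ω.IsAlt)
    (hnd : ω.Nondegenerate) (hf : ∀ x y, ω (f x) y = -ω x (f y)) {s t : ℝ} (hst : s ≠ t)
    (ht : t < 0) (hann : ∀ x, f (f (f (f x))) - (s + t) • f (f x) + (s * t) • x = 0)
    (hns : f * f ≠ s • 1) (hnt : f * f ≠ t • 1) : invariantLagrangianPlanes ω f = ∅ := by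
  rw [Set.eq_empty_iff_forall_notMem]
  intro P hP
  obtain ⟨v, hv, hv0, hfv⟩ := (exists_mem_eigenspace_sq hV hω hnd hf hst hann hns hP).2
  refine (exists_mem_eigenspace_sq hV hω hnd hf hst.symm
    (fun x => by rw [add_comm t, mul_comm t]; exact hann x) hnt hP).1 fun x hx => ?_
  have hli := linearIndependent_apply_of_sq_neg (f := f) (b := 0) (c := -t) (by linarith) hv0
    (by rw [hfv]; module)
  have hspan : Submodule.span ℝ (Set.range ![v, f v]) = P := by
    refine eq_of_linearIndependent_pair_of_mem (finrank_span_eq_card hli) hP.1 hli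
      (Submodule.subset_span ⟨0, rfl⟩) (Submodule.subset_span ⟨1, rfl⟩) hv (hP.2.2 v hv)
  rw [← hspan] at hx
  have hle : Submodule.span ℝ (Set.range ![v, f v]) ≤ LinearMap.ker (f * f - t • 1) := by
    rw [Submodule.span_le]
    rintro _ ⟨i, rfl⟩
    fin_cases i
    · simp [hfv]
    · simp [hfv]
  simpa using sub_eq_zero.1 (hle hx)

/-- If `f² - s` has square zero and rank at least two, its kernel is Lagrangian. -/
theorem ker_sq_sub_mem_invariantLagrangianPlanes (hV : finrank ℝ V = 4)
    (hf : ∀ x y, ω (f x) y = -ω x (f y)) {s : ℝ}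
    (hann : ∀ x, f (f (f (f x))) - (s + s) • f (f x) + (s * s) • x = 0)
    (hr : 2 ≤ finrank ℝ (LinearMap.range (f * f - s • 1))) :
    LinearMap.ker (f * f - s • 1) ∈ invariantLagrangianPlanes ω f := by
  set M : End ℝ V := f * f - s • 1 with hM
  have hMa : ∀ x, M x = f (f x) - s • x := fun x => by simp [hM]
  have hle : LinearMap.range M ≤ LinearMap.ker M := by
    rintro _ ⟨x, rfl⟩
    rw [LinearMap.mem_ker, ← hann x]
    simp only [hMa, map_sub, map_smul]
    module
  have hrn := LinearMap.finrank_range_add_finrank_ker M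
  have hm := Submodule.finrank_mono hle
  have heq : LinearMap.range M = LinearMap.ker M :=
    Submodule.eq_of_le_of_finrank_eq hle (by omega)
  refine ⟨by omega, fun x hx y hy => ?_, fun x hx => ?_⟩
  · rw [← heq] at hx
    obtain ⟨z, rfl⟩ := hx
    rw [LinearMap.mem_ker, hMa] at hy
    rw [hMa, map_sub, LinearMap.sub_apply, adjoint_sq hf, map_smul, LinearMap.smul_apply,
      ← map_smul, ← map_sub, hy, map_zero]
  · have := congrArg f (LinearMap.mem_ker.1 hx)
    rw [LinearMap.mem_ker]
    simpa [hMa] using this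

/-- The plane is `ker (f² - s)`. Since `s < 0`, every nonzero `v` in it forms a basis with `f v`,
and every invariant plane contains such a `v` because `(f² - s)² = 0`. -/
theorem encard_invariantLagrangianPlanes_eq_one (hV : finrank ℝ V = 4)
    (hf : ∀ x y, ω (f x) y = -ω x (f y)) {s : ℝ} (hs : s < 0)
    (hann : ∀ x, f (f (f (f x))) - (s + s) • f (f x) + (s * s) • x = 0)
    (hns : f * f ≠ s • 1) : (invariantLagrangianPlanes ω f).encard = 1 := by
  set M : End ℝ V := f * f - s • 1 with hM
  have hMa : ∀ x, M x = f (f x) - s • x := fun x => by simp [hM]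
  have hMM : M * M = 0 := by
    ext x
    rw [LinearMap.zero_apply, ← hann x]
    simp only [Module.End.mul_apply, hMa, map_sub, map_smul]
    module
  have hker : ∀ v, M v = 0 → v ≠ 0 → LinearIndependent ℝ ![v, f v] := fun v hv hv0 =>
    linearIndependent_apply_of_sq_neg (b := 0) (c := -s) (by linarith) hv0
      (by rw [← hv, hMa]; module)
  have hk : LinearMap.ker M ∈ invariantLagrangianPlanes ω f := by
    refine ker_sq_sub_mem_invariantLagrangianPlanes hV hf hann ?_
    -- The range of `M` is `f`-invariant and inside `ker M`, so one nonzero `M x` already gives rank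
    -- two.
    obtain ⟨x, hx⟩ : ∃ x, M x ≠ 0 := by
      by_contra! h
      exact sub_ne_zero.2 hns (LinearMap.ext h)
    have hli := hker (M x) (LinearMap.congr_fun hMM x) hx
    have hsub : Submodule.span ℝ (Set.range ![M x, f (M x)]) ≤ LinearMap.range M := by
      rw [Submodule.span_le]
      rintro _ ⟨i, rfl⟩
      fin_cases i
      · exact ⟨x, rfl⟩
      · exact ⟨f x, by simp [hMa]⟩
    have := Submodule.finrank_mono hsub
    rwa [finrank_span_eq_card hli] at this
  rw [Set.encard_eq_one]
  refine ⟨LinearMap.ker M, Set.eq_singleton_iff_unique_mem.2 ⟨hk, fun P hP => ?_⟩⟩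
  obtain ⟨h2, -, hinv⟩ := hP
  obtain ⟨v, hv, hv0, hMv⟩ : ∃ v ∈ P, v ≠ 0 ∧ M v = 0 := by
    rcases exists_mem_ker_or_le_ker (P := P) (B := M)
      (fun x hx => by
        rw [hMa]
        exact P.sub_mem (hinv _ (hinv _ hx)) (P.smul_mem _ hx)) hMM with h | h
    · exact h
    · obtain ⟨v, hv, hv0⟩ := exists_ne_zero_mem_of_finrank_eq_two h2
      exact ⟨v, hv, hv0, h v hv⟩
  exact eq_of_linearIndependent_pair_of_mem h2 hk.1 (hker v hMv hv0) hv (hinv v hv) hMv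
    (hk.2.2 v hMv)

/-- The planes are the kernels of `f² ± c f + m`. Neither factor has a real root, so a nonzero
vector killed by one of them determines its invariant plane. -/
theorem encard_invariantLagrangianPlanes_eq_two (hV : finrank ℝ V = 4) (hω : ω.IsAlt)
    (hnd : ω.Nondegenerate) (hf : ∀ x y, ω (f x) y = -ω x (f y)) {c m : ℝ} (hc : c ≠ 0)
    (hcm : c ^ 2 < 4 * m)
    (hann : ∀ x, f (f (f (f x))) + (2 * m - c ^ 2) • f (f x) + m ^ 2 • x = 0) :
    (invariantLagrangianPlanes ω f).encard = 2 := by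
  have hm : m ≠ 0 := by
    rintro rfl
    nlinarith [sq_nonneg c]
  have hann' : ∀ x, f (f (f (f x))) + (2 * m - (-c) ^ 2) • f (f x) + m ^ 2 • x = 0 := by
    simpa using hann
  have hp := ker_quadratic_mem_invariantLagrangianPlanes hV hω hnd hf hc hm hann
  have hn := ker_quadratic_mem_invariantLagrangianPlanes hV hω hnd hf (neg_ne_zero.2 hc) hm hann'
  have huniq : ∀ d : ℝ, d ^ 2 = c ^ 2 → ∀ P ∈ invariantLagrangianPlanes ω f,
      LinearMap.ker (f * f + d • f + m • 1) ∈ invariantLagrangianPlanes ω f →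
      ∀ v ∈ P, v ≠ 0 → f (f v) + d • f v + m • v = 0 →
      P = LinearMap.ker (f * f + d • f + m • 1) := by
    intro d hd P hP hk v hv hv0 h
    have hvk := mem_ker_quadratic.2 h
    exact eq_of_linearIndependent_pair_of_mem hP.1 hk.1
      (linearIndependent_apply_of_sq_neg (hd ▸ hcm) hv0 h) hv (hP.2.2 v hv) hvk (hk.2.2 v hvk)
  rw [Set.encard_eq_two]
  refine ⟨_, _, ?_, Set.Subset.antisymm (fun P hP => ?_) (Set.insert_subset hp
    (Set.singleton_subset_iff.2 hn))⟩
  · intro heq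
    obtain ⟨v, hv, hv0⟩ := exists_ne_zero_mem_of_finrank_eq_two hp.1
    exact hv0 (Submodule.disjoint_def.1 (disjoint_ker_quadratic hc hm) v hv (heq ▸ hv))
  · rcases exists_mem_ker_or_le_ker (P := P) (A := f * f + c • f + m • 1)
      (B := f * f + (-c) • f + m • 1)
      (fun x hx => P.add_mem (P.add_mem (hP.2.2 _ (hP.2.2 _ hx)) (P.smul_mem _ (hP.2.2 _ hx)))
        (P.smul_mem _ hx))
      (by
        ext x
        rw [LinearMap.zero_apply, ← hann x]
        simp only [LinearMap.add_apply, LinearMap.smul_apply, Module.End.mul_apply,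
          Module.End.one_apply, map_add, map_smul]
        module) with ⟨v, hv, hv0, h⟩ | h
    · exact Or.inl (huniq c rfl P hP hp v hv hv0 (mem_ker_quadratic.1 h))
    · obtain ⟨v, hv, hv0⟩ := exists_ne_zero_mem_of_finrank_eq_two hP.1
      exact Or.inr (huniq (-c) (by ring) P hP hn v hv hv0 (mem_ker_quadratic.1 (h v hv)))

end LinHam

/-! ### Real eigenvalues: the counts three and four -/

namespace LinHam

variable {V : Type*} [AddCommGroup V] [Module ℝ V] {ω : LinearMap.BilinForm ℝ V} {f : End ℝ V}

theorem linearIndependent_of_apply_eq_smul {r t : ℝ} (hrt : r ≠ t) {v w : V} (hv : f v = r • v)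
    (hw : f w = t • w) (hv0 : v ≠ 0) (hw0 : w ≠ 0) : LinearIndependent ℝ ![v, w] := by
  rw [LinearIndependent.pair_iff' hv0]
  rintro a rfl
  rw [map_smul, hv, smul_comm, ← sub_eq_zero, ← sub_smul] at hw
  exact (smul_eq_zero.1 hw).elim (sub_ne_zero.2 hrt) hw0

/-- A root of `(f - r)(f - t)` in an invariant subspace yields an eigenvector. -/
theorem exists_eigenvector_mem {P : Submodule ℝ V} (hP : ∀ x ∈ P, f x ∈ P) {r t : ℝ} {v : V}
    (hv : v ∈ P) (hv0 : v ≠ 0) (h : f (f v) + (-(r + t)) • f v + (r * t) • v = 0) :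
    ∃ w ∈ P, w ≠ 0 ∧ (f w = r • w ∨ f w = t • w) := by
  by_cases hw : f v = t • v
  · exact ⟨v, hv, hv0, Or.inr hw⟩
  · refine ⟨f v - t • v, P.sub_mem (hP v hv) (P.smul_mem _ hv), sub_ne_zero.2 hw, Or.inl ?_⟩
    rw [← sub_eq_zero, ← h, map_sub, map_smul]
    module

variable [FiniteDimensional ℝ V]

/-- The planes are the generalized eigenspaces `ker (f - a)²` and `ker (f + a)²`, and `ker (f² -
a²)`, spanned by one eigenvector for `a` and one for `-a`. -/
theorem encard_invariantLagrangianPlanes_eq_three (hV : finrank ℝ V = 4) (hω : ω.IsAlt)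
    (hnd : ω.Nondegenerate) (hf : ∀ x y, ω (f x) y = -ω x (f y)) {a : ℝ} (ha : a ≠ 0)
    (hann : ∀ x, f (f (f (f x))) - (a ^ 2 + a ^ 2) • f (f x) + (a ^ 2 * a ^ 2) • x = 0)
    (hns : f * f ≠ a ^ 2 • 1) : (invariantLagrangianPlanes ω f).encard = 3 := by
  have hm : a * a ≠ 0 := mul_ne_zero ha ha
  have hK : ∀ r : ℝ, r ^ 2 = a ^ 2 →
      LinearMap.ker (f * f + (-(r + r)) • f + (a * a) • 1) ∈ invariantLagrangianPlanes ω f := by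
    intro r hr
    have hr0 : r ≠ 0 := by
      rintro rfl
      exact ha (by simpa using hr.symm)
    refine ker_quadratic_mem_invariantLagrangianPlanes hV hω hnd hf
      (neg_ne_zero.2 (by simpa [← two_mul] using hr0)) hm fun x => ?_
    have h4 : (-(r + r)) ^ 2 = 4 * a ^ 2 := by rw [← hr]; ring
    rw [h4, ← hann x]
    module
  -- If `f = r` on the Lagrangian plane `ker (f - r)²`, then `(f + r) y` is orthogonal to it for all
  -- `y`, hence in it, so `(f - r)(f + r) y = 0`, contradicting `f² ≠ a²`.
  have hdiag : ∀ r : ℝ, r ^ 2 = a ^ 2 →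
      ∃ u, f (f u) + (-(r + r)) • f u + (a * a) • u = 0 ∧ f u - r • u ≠ 0 := by
    intro r hr
    by_contra! hcon
    apply hns
    ext y
    have hy : f y + r • y ∈ LinearMap.ker (f * f + (-(r + r)) • f + (a * a) • 1) := by
      refine mem_of_orthogonal_lagrangian hV hω hnd (hK r hr).1 (hK r hr).2.1 fun x hx => ?_
      have hx' := hcon x (mem_ker_quadratic.1 hx)
      rw [map_add, map_smul, LinearMap.add_apply, LinearMap.smul_apply, hf, sub_eq_zero.1 hx']
      simp
    have h := hcon _ (mem_ker_quadratic.1 hy)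
    have h' : f (f y) - r ^ 2 • y = 0 := by
      rw [← h, map_add, map_smul]
      module
    rw [hr] at h'
    simpa using sub_eq_zero.1 h'
  have hra : (-a) ^ 2 = a ^ 2 := by ring
  have hne : a ≠ -a := fun h => ha (by linarith)
  have hRk : LinearMap.ker (f * f - (a ^ 2) • 1) ∈ invariantLagrangianPlanes ω f := by
    refine ker_sq_sub_mem_invariantLagrangianPlanes hV hf hann ?_
    have hvec : ∀ r : ℝ, r ^ 2 = a ^ 2 →
        ∃ v ∈ LinearMap.range (f * f - (a ^ 2) • 1), v ≠ 0 ∧ f v = r • v := by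
      intro r hr
      obtain ⟨u, hu, hu0⟩ := hdiag r hr
      have hr0 : r ≠ 0 := by
        rintro rfl
        exact ha (by simpa using hr.symm)
      -- On `ker (f - r)²` one has `f² - r² = 2r (f - r)`.
      refine ⟨(2 * r) • (f u - r • u), ⟨u, ?_⟩, smul_ne_zero (by simpa using hr0) hu0, ?_⟩
      · rw [← sub_eq_zero, ← hu, LinearMap.sub_apply, LinearMap.smul_apply,
          Module.End.mul_apply, Module.End.one_apply, ← sq, ← hr]
        module
      · rw [map_smul, smul_comm r]
        congr 1
        rw [← sub_eq_zero, ← hu, map_sub, map_smul, ← sq, ← hr]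
        module
    obtain ⟨v, hv, hv0, hfv⟩ := hvec a rfl
    obtain ⟨w, hw, hw0, hfw⟩ := hvec (-a) hra
    have hli := linearIndependent_of_apply_eq_smul hne hfv hfw hv0 hw0
    have hsub : Submodule.span ℝ (Set.range ![v, w]) ≤ LinearMap.range (f * f - (a ^ 2) • 1) := by
      rw [Submodule.span_le]
      rintro _ ⟨i, rfl⟩
      fin_cases i
      · exact hv
      · exact hw
    have := Submodule.finrank_mono hsub
    rwa [finrank_span_eq_card hli] at this
  have hKR : ∀ r : ℝ, r ^ 2 = a ^ 2 → LinearMap.ker (f * f + (-(r + r)) • f + (a * a) • 1) ≠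
      LinearMap.ker (f * f - (a ^ 2) • 1) := by
    intro r hr heq
    have hr0 : r ≠ 0 := by
      rintro rfl
      exact ha (by simpa using hr.symm)
    obtain ⟨u, hu, hu0⟩ := hdiag r hr
    have hu' := mem_ker_quadratic.2 hu
    rw [heq, LinearMap.mem_ker, LinearMap.sub_apply, LinearMap.smul_apply,
      Module.End.mul_apply, Module.End.one_apply, sub_eq_zero] at hu'
    have h : (2 * r) • (f u - r • u) = 0 := by
      rw [← neg_zero, ← hu, hu', ← sq, ← hr]
      module
    exact hu0 ((smul_eq_zero.1 h).resolve_left (by simpa using hr0))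
  have hprod : ∀ r : ℝ, r ^ 2 = a ^ 2 → (f * f + (-(r + r)) • f + (a * a) • 1) *
      (f * f + (-(-r + -r)) • f + (a * a) • 1) = 0 := by
    intro r hr
    ext x
    rw [LinearMap.zero_apply, ← hann x, show a * a = r ^ 2 by rw [hr, sq], ← hr]
    simp only [LinearMap.add_apply, LinearMap.smul_apply, Module.End.mul_apply,
      Module.End.one_apply, map_add, map_smul]
    module
  -- From `(f - r)² (f + r)² = 0`: either `(f - r)²` kills a nonzero vector of `P`, giving an
  -- eigenvector for `r`, or `P` is `ker (f + r)²`.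
  have halt : ∀ P ∈ invariantLagrangianPlanes ω f, ∀ r : ℝ, r ^ 2 = a ^ 2 →
      (∃ v ∈ P, v ≠ 0 ∧ f v = r • v) ∨
        P = LinearMap.ker (f * f + (-(-r + -r)) • f + (a * a) • 1) := by
    intro P hP r hr
    rcases exists_mem_ker_or_le_ker (P := P)
      (fun x hx => P.add_mem (P.add_mem (hP.2.2 _ (hP.2.2 _ hx)) (P.smul_mem _ (hP.2.2 _ hx)))
        (P.smul_mem _ hx)) (hprod r hr) with ⟨v, hv, hv0, h⟩ | h
    · have h' := mem_ker_quadratic.1 h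
      rw [← sq, ← hr, sq] at h'
      obtain ⟨w, hw, hw0, hfw⟩ := exists_eigenvector_mem hP.2.2 hv hv0 h'
      exact Or.inl ⟨w, hw, hw0, hfw.elim id id⟩
    · exact Or.inr (Submodule.eq_of_le_of_finrank_eq (fun x hx => h x hx)
        (hP.1.trans (hK (-r) (by rw [← hr]; ring)).1.symm))
  rw [Set.encard_eq_three]
  refine ⟨_, _, _, ?_, hKR a rfl, hKR (-a) hra, Set.Subset.antisymm (fun P hP => ?_)
    (Set.insert_subset (hK a rfl) (Set.insert_subset (hK (-a) hra)
      (Set.singleton_subset_iff.2 hRk)))⟩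
  · intro heq
    obtain ⟨v, hv, hv0⟩ := exists_ne_zero_mem_of_finrank_eq_two (hK a rfl).1
    have hd := disjoint_ker_quadratic (f := f) (c := -(a + a)) (m := a * a)
      (neg_ne_zero.2 (by simpa [← two_mul] using ha)) hm
    refine hv0 (Submodule.disjoint_def.1 hd v hv ?_)
    rw [heq] at hv
    convert hv using 5
    ring
  · rcases halt P hP a rfl with ⟨v, hv, hv0, hfv⟩ | h
    · rcases halt P hP (-a) hra with ⟨w, hw, hw0, hfw⟩ | h
      · refine Or.inr (Or.inr (eq_of_linearIndependent_pair_of_mem hP.1 hRk.1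
          (linearIndependent_of_apply_eq_smul hne hfv hfw hv0 hw0) hv hw ?_ ?_))
        · simp [hfv, smul_smul, sq]
        · simp [hfw, smul_smul, sq]
      · left
        rw [h, neg_neg]
    · exact Or.inr (Or.inl h)

/-- An invariant Lagrangian plane is spanned by an eigenvector for one of `±a` and one for one of
`±b`; the four sign choices, indexed by `I`, all occur and give distinct planes. -/
theorem encard_invariantLagrangianPlanes_eq_four (hV : finrank ℝ V = 4) (hω : ω.IsAlt)
    (hnd : ω.Nondegenerate) (hf : ∀ x y, ω (f x) y = -ω x (f y)) {a b : ℝ} (ha : a ≠ 0)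
    (hb : b ≠ 0) (hab : a ^ 2 ≠ b ^ 2)
    (hann : ∀ x, f (f (f (f x))) - (a ^ 2 + b ^ 2) • f (f x) + (a ^ 2 * b ^ 2) • x = 0)
    (hna : f * f ≠ a ^ 2 • 1) (hnb : f * f ≠ b ^ 2 • 1) :
    (invariantLagrangianPlanes ω f).encard = 4 := by
  have hann' : ∀ x, f (f (f (f x))) - (b ^ 2 + a ^ 2) • f (f x) + (b ^ 2 * a ^ 2) • x = 0 :=
    fun x => by rw [add_comm (b ^ 2), mul_comm (b ^ 2)]; exact hann x
  set F : ℝ × ℝ → Submodule ℝ V := fun p =>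
    LinearMap.ker (f * f + (-(p.1 + p.2)) • f + (p.1 * p.2) • 1) with hF
  set I : Set (ℝ × ℝ) := {a, -a} ×ˢ {b, -b} with hI
  have hIa : ∀ p ∈ I, p.1 ^ 2 = a ^ 2 := fun p hp => sq_eq_sq_iff_eq_or_eq_neg.2 hp.1
  have hIb : ∀ p ∈ I, p.2 ^ 2 = b ^ 2 := fun p hp => sq_eq_sq_iff_eq_or_eq_neg.2 hp.2
  have hmem : ∀ p ∈ I, F p ∈ invariantLagrangianPlanes ω f := by
    intro p hp
    have h1 := hIa p hp
    have h2 := hIb p hp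
    refine ker_quadratic_mem_invariantLagrangianPlanes hV hω hnd hf ?_ ?_ fun x => ?_
    · intro h
      apply hab
      rw [← h1, ← h2]
      linear_combination (p.2 - p.1) * h
    · intro h
      have : a ^ 2 * b ^ 2 = 0 := by rw [← h1, ← h2, ← mul_pow, h]; ring
      simp [ha, hb] at this
    · rw [← hann x, ← h1, ← h2]
      module
  have hexa : ∀ P ∈ invariantLagrangianPlanes ω f, ∀ c d : ℝ, c ^ 2 ≠ d ^ 2 →
      (∀ x, f (f (f (f x))) - (d ^ 2 + c ^ 2) • f (f x) + (d ^ 2 * c ^ 2) • x = 0) →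
      f * f ≠ d ^ 2 • 1 → ∃ r : ℝ, (r = c ∨ r = -c) ∧ ∃ v ∈ P, v ≠ 0 ∧ f v = r • v := by
    intro P hP c d hcd hc hnd'
    obtain ⟨v, hv, hv0, hfv⟩ := (exists_mem_eigenspace_sq hV hω hnd hf hcd.symm hc hnd' hP).2
    obtain ⟨w, hw, hw0, h | h⟩ := exists_eigenvector_mem (f := f) (r := c) (t := -c) hP.2.2 hv hv0
      (by rw [hfv]; module)
    · exact ⟨c, Or.inl rfl, w, hw, hw0, h⟩
    · exact ⟨-c, Or.inr rfl, w, hw, hw0, h⟩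
  have hroot : ∀ p : ℝ × ℝ, ∀ r : ℝ, ∀ v ∈ F p, v ≠ 0 → f v = r • v → r = p.1 ∨ r = p.2 := by
    intro p r v hv hv0 hfv
    have h := mem_ker_quadratic.1 hv
    have h' : ((r - p.1) * (r - p.2)) • v = 0 := by
      rw [← h, hfv, map_smul, hfv]
      module
    rcases mul_eq_zero.1 ((smul_eq_zero.1 h').resolve_right hv0) with h | h
    · exact Or.inl (sub_eq_zero.1 h)
    · exact Or.inr (sub_eq_zero.1 h)
  have hinj : Set.InjOn F I := by
    intro p hp q hq hpq
    have hP := hmem p hp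
    obtain ⟨r, hr, v, hv, hv0, hfv⟩ := hexa _ hP a b hab hann' hnb
    obtain ⟨t, ht, w, hw, hw0, hfw⟩ := hexa _ hP b a hab.symm hann hna
    have hr2 : r ^ 2 = a ^ 2 := sq_eq_sq_iff_eq_or_eq_neg.2 hr
    have ht2 : t ^ 2 = b ^ 2 := sq_eq_sq_iff_eq_or_eq_neg.2 ht
    have h1 : ∀ p' ∈ I, F p = F p' → r = p'.1 := by
      intro p' hp' h
      refine (hroot p' r v (h ▸ hv) hv0 hfv).resolve_right fun h => hab ?_
      rw [← hr2, h, hIb p' hp']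
    have h2 : ∀ p' ∈ I, F p = F p' → t = p'.2 := by
      intro p' hp' h
      refine (hroot p' t w (h ▸ hw) hw0 hfw).resolve_left fun h => hab ?_
      rw [← ht2, h, hIa p' hp']
    exact Prod.ext ((h1 p hp rfl).symm.trans (h1 q hq hpq))
      ((h2 p hp rfl).symm.trans (h2 q hq hpq))
  have himage : invariantLagrangianPlanes ω f = F '' I := by
    refine Set.Subset.antisymm (fun P hP => ?_) (Set.image_subset_iff.2 hmem)
    obtain ⟨r, hr, v, hv, hv0, hfv⟩ := hexa _ hP a b hab hann' hnb
    obtain ⟨t, ht, w, hw, hw0, hfw⟩ := hexa _ hP b a hab.symm hann hna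
    have hrt : r ≠ t := by
      rintro rfl
      exact hab ((sq_eq_sq_iff_eq_or_eq_neg.2 hr).symm.trans (sq_eq_sq_iff_eq_or_eq_neg.2 ht))
    have hp : (r, t) ∈ I := ⟨hr, ht⟩
    refine ⟨(r, t), hp, (eq_of_linearIndependent_pair_of_mem hP.1 (hmem _ hp).1
      (linearIndependent_of_apply_eq_smul hrt hfv hfw hv0 hw0) hv hw ?_ ?_).symm⟩
    · refine mem_ker_quadratic.2 ?_
      rw [hfv, map_smul, hfv]
      module
    · refine mem_ker_quadratic.2 ?_
      rw [hfw, map_smul, hfw]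
      module
  rw [himage, hinj.encard_image, hI, Set.encard_prod, Set.encard_pair, Set.encard_pair]
  · norm_num
  · intro h
    exact hb (by linarith)
  · intro h
    exact ha (by linarith)

end LinHam

/-! ### Spectrum of a matrix with even characteristic polynomial -/

namespace LinHam

open Matrix Polynomial

section Spectrum

variable {L : Matrix (Fin 4) (Fin 4) ℝ}

theorem eval_neg_charpoly (h : (-L).charpoly = L.charpoly) (t : ℝ) :
    L.charpoly.eval (-t) = L.charpoly.eval t := by
  conv_rhs => rw [← h]
  have hneg : scalar (Fin 4) (-t) - L = -(scalar (Fin 4) t - -L) := by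
    rw [map_neg]
    abel
  rw [Matrix.eval_charpoly, Matrix.eval_charpoly, hneg, Matrix.det_neg, Fintype.card_fin]
  norm_num

theorem exists_charpoly_eq (h : (-L).charpoly = L.charpoly) :
    ∃ a b : ℝ, L.charpoly = X ^ 4 + C a * X ^ 2 + C b := by
  have hd : L.charpoly.natDegree = 4 := by simp
  have hm : L.charpoly.coeff 4 = 1 := by
    have := L.charpoly_monic
    rwa [Monic, leadingCoeff, hd] at this
  have hp : L.charpoly = X ^ 4 + C (L.charpoly.coeff 3) * X ^ 3 + C (L.charpoly.coeff 2) * X ^ 2 +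
      C (L.charpoly.coeff 1) * X + C (L.charpoly.coeff 0) := by
    conv_lhs => rw [L.charpoly.as_sum_range_C_mul_X_pow, hd]
    simp only [Finset.sum_range_succ, Finset.sum_range_zero, hm]
    simp
    ring
  have hev := eval_neg_charpoly h
  -- Evenness at `1` and `2` gives two independent equations for the two odd coefficients.
  have h1 := hev 1
  have h2 := hev 2
  rw [hp] at h1 h2
  simp at h1 h2
  refine ⟨L.charpoly.coeff 2, L.charpoly.coeff 0, ?_⟩
  have h3 : L.charpoly.coeff 3 = 0 := by linarith
  have h4 : L.charpoly.coeff 1 = 0 := by linarith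
  rw [h3, h4] at hp
  simpa using hp

theorem charpoly_map_eq_of_eigenvalues_eq {z₁ z₂ z₃ z₄ : ℂ}
    (h : eigenvalues L = {z₁, z₂, z₃, z₄}) :
    L.charpoly.map (algebraMap ℝ ℂ) = (X - C z₁) * (X - C z₂) * (X - C z₃) * (X - C z₄) := by
  rw [eigenvalues, Matrix.charpoly_map] at h
  have := (IsAlgClosed.splits (L.charpoly.map (algebraMap ℝ ℂ))).eq_prod_roots_of_monic
    (L.charpoly_monic.map _)
  rw [this, h]
  simp [mul_assoc]

/-- The eigenvalues of an infinitesimally symplectic matrix come in opposite pairs. -/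
theorem exists_eigenvalues_eq (h : (-L).charpoly = L.charpoly) :
    ∃ μ ν : ℂ, eigenvalues L = {μ, -μ, ν, -ν} := by
  obtain ⟨a, b, hp⟩ := exists_charpoly_eq h
  -- `d` is a square root of the discriminant of `Y² + aY + b`, whose roots are `μ²` and `ν²`.
  obtain ⟨d, hd⟩ := IsAlgClosed.exists_pow_nat_eq ((a : ℂ) ^ 2 - 4 * b) two_pos
  obtain ⟨μ, hμ⟩ := IsAlgClosed.exists_pow_nat_eq ((-a + d) / 2 : ℂ) two_pos
  obtain ⟨ν, hν⟩ := IsAlgClosed.exists_pow_nat_eq ((-a - d) / 2 : ℂ) two_pos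
  refine ⟨μ, ν, ?_⟩
  have ha : (a : ℂ) = -(μ ^ 2 + ν ^ 2) := by rw [hμ, hν]; ring
  have hb : (b : ℂ) = μ ^ 2 * ν ^ 2 := by
    rw [hμ, hν]
    linear_combination (1 / 4 : ℂ) * hd
  have hprod : L.charpoly.map (algebraMap ℝ ℂ) =
      (({μ, -μ, ν, -ν} : Multiset ℂ).map fun z => X - C z).prod := by
    rw [hp]
    simp [ha, hb]
    ring
  rw [eigenvalues, Matrix.charpoly_map, hprod, roots_multiset_prod_X_sub_C]

theorem toLin'_annihilated {a b : ℝ} (hp : L.charpoly = X ^ 4 + C a * X ^ 2 + C b)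
    (x : Fin 4 → ℝ) : toLin' L (toLin' L (toLin' L (toLin' L x))) + a • toLin' L (toLin' L x) +
      b • x = 0 := by
  have h := L.aeval_self_charpoly
  rw [hp] at h
  have h' := congrArg (fun M => M *ᵥ x) h
  simpa [Algebra.algebraMap_eq_smul_one, pow_succ, add_mulVec, smul_mulVec, ← mulVec_mulVec,
    mul_assoc] using h'

theorem charpoly_eq_of_map_eq {p : ℝ[X]} (h : L.charpoly.map (algebraMap ℝ ℂ) =
    p.map (algebraMap ℝ ℂ)) : L.charpoly = p :=
  map_injective _ (algebraMap ℝ ℂ).injective h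

/-- The annihilating polynomial when the squares of the eigenvalues are real. -/
theorem toLin'_annihilated_of_eigenvalues_eq {μ ν : ℂ} (h : eigenvalues L = {μ, -μ, ν, -ν})
    {s t : ℝ} (hs : μ ^ 2 = s) (ht : ν ^ 2 = t) (x : Fin 4 → ℝ) :
    toLin' L (toLin' L (toLin' L (toLin' L x))) - (s + t) • toLin' L (toLin' L x) +
      (s * t) • x = 0 := by
  rw [sub_eq_add_neg, ← neg_smul]
  refine toLin'_annihilated (charpoly_eq_of_map_eq ?_) x
  rw [charpoly_map_eq_of_eigenvalues_eq h]
  have hs' : C (s : ℂ) = C μ ^ 2 := by rw [← hs, C_pow]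
  have ht' : C (t : ℂ) = C ν ^ 2 := by rw [← ht, C_pow]
  simp [hs', ht']
  ring

theorem sq_eq_of_mem_eigenvalues {r : ℝ} (h : toLin' L * toLin' L = r • 1) {μ : ℂ}
    (hμ : μ ∈ eigenvalues L) : μ ^ 2 = r := by
  have hL : L * L = r • 1 := by
    apply toLin'.injective
    rw [toLin'_mul, map_smul, toLin'_one]
    exact h
  set A := L.map (algebraMap ℝ ℂ) with hA
  have hAA : A * A = (r : ℂ) • 1 := by
    rw [hA, ← Matrix.map_mul, hL]
    ext i j
    by_cases hij : i = j <;> simp [hij]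
  have hroot := isRoot_of_mem_roots hμ
  rw [IsRoot, Matrix.eval_charpoly, ← Matrix.exists_mulVec_eq_zero_iff] at hroot
  obtain ⟨v, hv0, hv⟩ := hroot
  have hv' : A *ᵥ v = μ • v := by
    rw [sub_mulVec, sub_eq_zero] at hv
    rw [← hv]
    simp [Matrix.scalar_apply]
  have h2 : (μ ^ 2 - r) • v = 0 := by
    have := congrArg (fun M => M *ᵥ v) hAA
    simp only [← mulVec_mulVec, hv', mulVec_smul, smul_mulVec, one_mulVec] at this
    rw [sub_smul, sub_eq_zero, ← this, sq, mul_smul]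
  exact sub_eq_zero.1 ((smul_eq_zero.1 h2).resolve_right hv0)

/-- For `r ≠ 0` the polynomial `X² - r` is separable, so `L² = r` would make `L` semisimple. Then `n
= L - s` is both semisimple and nilpotent, hence zero. -/
theorem sq_ne_smul_one_of_hasNonzeroNilpotentPart (h : HasNonzeroNilpotentPart L) {r : ℝ}
    (hr : r ≠ 0) : toLin' L * toLin' L ≠ r • 1 := by
  intro hL
  obtain ⟨s, n, hs, hn, hc, hsum, hn0⟩ := h
  have hss : End.IsSemisimple (toLin' L) := by
    refine End.isSemisimple_of_squarefree_aeval_eq_zero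
      (separable_X_pow_sub_C (n := 2) r (by norm_num) hr).squarefree ?_
    rw [map_sub, map_pow, aeval_X, aeval_C, sq, hL, Algebra.algebraMap_eq_smul_one, sub_self]
  apply hn0
  have hn' : n = toLin' L - s := by rw [hsum]; abel
  refine End.eq_zero_of_isNilpotent_isSemisimple hn ?_
  rw [hn']
  refine End.IsSemisimple.sub_of_commute ?_ hss hs
  rw [hsum]
  exact (Commute.refl s).add_left hc.symm

theorem sq_ne_sq_of_hasSimpleEigenvalues {μ ν : ℂ} (h : eigenvalues L = {μ, -μ, ν, -ν})
    (hL : HasSimpleEigenvalues L) : μ ^ 2 ≠ ν ^ 2 := by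
  rw [HasSimpleEigenvalues, h] at hL
  intro hsq
  rcases sq_eq_sq_iff_eq_or_eq_neg.1 hsq with rfl | rfl <;> simp at hL

theorem sq_eq_sq_of_hasDoubleEigenvalues {μ ν : ℂ} (h : eigenvalues L = {μ, -μ, ν, -ν})
    (hL : HasDoubleEigenvalues L) (hμ : μ ≠ 0) : μ ^ 2 = ν ^ 2 := by
  have h2 := hL μ (by simp [h])
  rw [sq_eq_sq_iff_eq_or_eq_neg]
  by_contra! hne
  have h0 : μ ≠ -μ := fun h' => hμ (self_eq_neg.1 h')
  rw [h] at h2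
  simp [hne.1, hne.2, h0] at h2

theorem ne_zero_of_mem_eigenvalues (hdet : L.det ≠ 0) {μ : ℂ} (hμ : μ ∈ eigenvalues L) :
    μ ≠ 0 := by
  rintro rfl
  have hroot := isRoot_of_mem_roots hμ
  rw [IsRoot, Matrix.charpoly_map, eval_map_algebraMap, ← map_zero (algebraMap ℝ ℂ),
    aeval_algebraMap_apply] at hroot
  have h0 := (algebraMap ℝ ℂ).injective hroot
  apply hdet
  rw [det_eq_sign_charpoly_coeff, coeff_zero_eq_eval_zero]
  simpa using h0

end Spectrum

/-! ### From the null-cone to invariant planes -/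

section Hamiltonian

variable {ω : LinearMap.BilinForm ℝ (Fin 4 → ℝ)} {H : QuadraticForm ℝ (Fin 4 → ℝ)}

theorem isUnit_det_toMatrix₂' (hnd : ω.Nondegenerate) :
    IsUnit (LinearMap.toMatrix₂' ℝ ω).det :=
  isUnit_iff_ne_zero.2 (Matrix.nondegenerate_iff_det_ne_zero.1
    (LinearMap.nondegenerate_toMatrix₂'_iff.2 hnd))

theorem apply_systemMatrix (hnd : ω.Nondegenerate) (x y : Fin 4 → ℝ) :
    ω x (toLin' (systemMatrix ω H) y) = QuadraticMap.associated (R := ℝ) H x y := by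
  rw [← Matrix.toLinearMap₂'_toMatrix' (R := ℝ) ω,
    ← Matrix.toLinearMap₂'_toMatrix' (R := ℝ) (QuadraticMap.associated (R := ℝ) H),
    Matrix.toLinearMap₂'_apply', Matrix.toLinearMap₂'_apply', toLin'_apply, mulVec_mulVec,
    Matrix.toLinearMap₂'_toMatrix' (R := ℝ) ω, systemMatrix,
    Matrix.mul_nonsing_inv_cancel_left _ _ (isUnit_det_toMatrix₂' hnd)]
  rfl

theorem systemMatrix_skew (hω : ω.IsAlt) (hnd : ω.Nondegenerate) (x y : Fin 4 → ℝ) :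
    ω (toLin' (systemMatrix ω H) x) y = -ω x (toLin' (systemMatrix ω H) y) := by
  rw [← hω.neg_eq, apply_systemMatrix hnd, apply_systemMatrix hnd, neg_inj]
  exact QuadraticMap.associated_isSymm ℝ H y x

/-- `(-L)ᵀ = S Ω⁻¹`, which has the same characteristic polynomial as `Ω⁻¹ S = L`. -/
theorem charpoly_neg_systemMatrix (hω : ω.IsAlt) (hnd : ω.Nondegenerate) :
    (-systemMatrix ω H).charpoly = (systemMatrix ω H).charpoly := by
  have hΩ : (LinearMap.toMatrix₂' ℝ ω)ᵀ = -LinearMap.toMatrix₂' ℝ ω := by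
    ext i j
    simp [LinearMap.toMatrix₂'_apply, hω.neg_eq]
  have hinv : (LinearMap.toMatrix₂' ℝ ω)⁻¹ᵀ = -(LinearMap.toMatrix₂' ℝ ω)⁻¹ := by
    rw [transpose_nonsing_inv, hΩ]
    refine inv_eq_left_inv ?_
    rw [neg_mul_neg, nonsing_inv_mul _ (isUnit_det_toMatrix₂' hnd)]
  rw [← charpoly_transpose, systemMatrix, transpose_neg, transpose_mul, hinv,
    (QuadraticForm.isSymm_toMatrix' H).eq, mul_neg, neg_neg, charpoly_mul_comm]

theorem lagrangianPlanesInNullCone_eq (hω : ω.IsAlt) (hnd : ω.Nondegenerate) :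
    lagrangianPlanesInNullCone ω H =
      invariantLagrangianPlanes ω (toLin' (systemMatrix ω H)) := by
  ext P
  constructor
  · rintro ⟨⟨h2, hiso⟩, hnull⟩
    refine ⟨h2, hiso, fun x hx => ?_⟩
    refine mem_of_orthogonal_lagrangian (by simp) hω hnd h2 hiso fun y hy => ?_
    have hx0 : H x = 0 := hnull hx
    have hy0 : H y = 0 := hnull hy
    have hxy0 : H (x + y) = 0 := hnull (P.add_mem hx hy)
    rw [systemMatrix_skew hω hnd, apply_systemMatrix hnd, QuadraticMap.associated_apply, hx0, hy0,
      hxy0]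
    simp
  · rintro ⟨h2, hiso, hinv⟩
    refine ⟨⟨h2, hiso⟩, fun x hx => ?_⟩
    have := hiso x hx _ (hinv x hx)
    rwa [apply_systemMatrix hnd, QuadraticMap.associated_eq_self_apply] at this

end Hamiltonian

end LinHam

/-! ### The five spectral cases -/

theorem theorem1 (ω : LinearMap.BilinForm ℝ (Fin 4 → ℝ)) (H : QuadraticForm ℝ (Fin 4 → ℝ))
    (hω_alt : ω.IsAlt) (hω_nondeg : ω.Nondegenerate)
    (hH_nondeg : H.toMatrix'.det ≠ 0)
    (hH_sig : sigPos H = sigNeg H) :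
    (LinHam.IsElliptic (LinHam.systemMatrix ω H) →
      LinHam.HasSimpleEigenvalues (LinHam.systemMatrix ω H) →
      (LinHam.lagrangianPlanesInNullCone ω H).encard = 0) ∧
    (LinHam.IsElliptic (LinHam.systemMatrix ω H) →
      LinHam.HasDoubleEigenvalues (LinHam.systemMatrix ω H) →
      LinHam.HasNonzeroNilpotentPart (LinHam.systemMatrix ω H) →
      (LinHam.lagrangianPlanesInNullCone ω H).encard = 1) ∧
    (LinHam.IsHyperbolic (LinHam.systemMatrix ω H) →
      LinHam.HasComplexQuadruplet (LinHam.systemMatrix ω H) →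
      (LinHam.lagrangianPlanesInNullCone ω H).encard = 2) ∧
    (LinHam.IsHyperbolic (LinHam.systemMatrix ω H) →
      LinHam.HasRealEigenvalues (LinHam.systemMatrix ω H) →
      LinHam.HasDoubleEigenvalues (LinHam.systemMatrix ω H) →
      LinHam.HasNonzeroNilpotentPart (LinHam.systemMatrix ω H) →
      (LinHam.lagrangianPlanesInNullCone ω H).encard = 3) ∧
    (LinHam.IsHyperbolic (LinHam.systemMatrix ω H) →
      LinHam.HasRealEigenvalues (LinHam.systemMatrix ω H) →
      LinHam.HasSimpleEigenvalues (LinHam.systemMatrix ω H) →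
      (LinHam.lagrangianPlanesInNullCone ω H).encard = 4) := by
  have hV : Module.finrank ℝ (Fin 4 → ℝ) = 4 := by simp
  have hskew := LinHam.systemMatrix_skew (H := H) hω_alt hω_nondeg
  have hdet : (LinHam.systemMatrix ω H).det ≠ 0 := by
    rw [LinHam.systemMatrix, Matrix.det_mul]
    exact mul_ne_zero (Matrix.isUnit_nonsing_inv_det _
      (LinHam.isUnit_det_toMatrix₂' hω_nondeg)).ne_zero hH_nondeg
  obtain ⟨μ, ν, hE⟩ := LinHam.exists_eigenvalues_eq
    (LinHam.charpoly_neg_systemMatrix (H := H) hω_alt hω_nondeg)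
  have hμE : μ ∈ LinHam.eigenvalues (LinHam.systemMatrix ω H) := by simp [hE]
  have hνE : ν ∈ LinHam.eigenvalues (LinHam.systemMatrix ω H) := by simp [hE]
  have hμ0 := LinHam.ne_zero_of_mem_eigenvalues hdet hμE
  have hν0 := LinHam.ne_zero_of_mem_eigenvalues hdet hνE
  have him : ∀ z : ℂ, z.re = 0 → z ^ 2 = ((-z.im ^ 2 : ℝ) : ℂ) := by
    intro z hz
    apply Complex.ext <;> simp [sq, hz]
  have hre : ∀ z : ℂ, z.im = 0 → z ^ 2 = ((z.re ^ 2 : ℝ) : ℂ) := by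
    intro z hz
    apply Complex.ext <;> simp [sq, hz]
  have himneg : ∀ z : ℂ, z ≠ 0 → z.re = 0 → -z.im ^ 2 < 0 := by
    intro z hz hz'
    have : z.im ≠ 0 := fun h => hz (Complex.ext hz' h)
    have := sq_pos_of_ne_zero this
    linarith
  rw [LinHam.lagrangianPlanesInNullCone_eq hω_alt hω_nondeg]
  refine ⟨fun hell hsimp => ?_, fun hell hdbl hnil => ?_, fun _ hquad => ?_,
    fun hhyp hreal hdbl hnil => ?_, fun hhyp hreal hsimp => ?_⟩
  · have hs := him μ (hell μ hμE)
    have ht := him ν (hell ν hνE)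
    have hne := LinHam.sq_ne_sq_of_hasSimpleEigenvalues hE hsimp
    rw [LinHam.invariantLagrangianPlanes_eq_empty hV hω_alt hω_nondeg hskew ?_
      (himneg ν hν0 (hell ν hνE)) (LinHam.toLin'_annihilated_of_eigenvalues_eq hE hs ht) ?_ ?_,
      Set.encard_empty]
    · intro h
      exact hne (by rw [hs, ht, h])
    · intro h
      exact hne (by rw [hs, LinHam.sq_eq_of_mem_eigenvalues h hνE])
    · intro h
      exact hne (by rw [ht, LinHam.sq_eq_of_mem_eigenvalues h hμE])
  · have hs := him μ (hell μ hμE)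
    have hlt := himneg μ hμ0 (hell μ hμE)
    have ht := hs
    rw [LinHam.sq_eq_sq_of_hasDoubleEigenvalues hE hdbl hμ0] at ht
    exact LinHam.encard_invariantLagrangianPlanes_eq_one hV hskew hlt
      (LinHam.toLin'_annihilated_of_eigenvalues_eq hE hs ht)
      (LinHam.sq_ne_smul_one_of_hasNonzeroNilpotentPart hnil hlt.ne)
  · obtain ⟨κ, η, hκ, hη, hQ⟩ := hquad
    -- `X² ± 2κX + (κ² + η²)` are the factors with roots `∓κ ± iη`; `c² < 4m` amounts to `η ≠ 0`.
    refine LinHam.encard_invariantLagrangianPlanes_eq_two (c := 2 * κ) (m := κ ^ 2 + η ^ 2)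
      hV hω_alt hω_nondeg hskew (by simpa using hκ) ?_
      (LinHam.toLin'_annihilated (LinHam.charpoly_eq_of_map_eq ?_))
    · have := sq_pos_of_ne_zero hη
      linarith
    · have hz : ∀ x y : ℝ, Polynomial.C (⟨x, y⟩ : ℂ) =
          Polynomial.C (x : ℂ) + Polynomial.C (y : ℂ) * Polynomial.C Complex.I := by
        intro x y
        rw [← Polynomial.C_mul, ← Polynomial.C_add, ← Complex.mk_eq_add_mul_I]
      have hI : (Polynomial.C Complex.I : Polynomial ℂ) ^ 2 = -1 := by
        rw [← Polynomial.C_pow, Complex.I_sq, Polynomial.C_neg, Polynomial.C_1]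
      rw [LinHam.charpoly_map_eq_of_eigenvalues_eq hQ, hz κ η, hz κ (-η), hz (-κ) η, hz (-κ) (-η)]
      simp only [Polynomial.map_add, Polynomial.map_sub, Polynomial.map_mul, Polynomial.map_pow,
        Polynomial.map_X, Polynomial.map_C, Polynomial.map_ofNat, Complex.coe_algebraMap,
        Complex.ofReal_neg, Polynomial.C_sub, Polynomial.C_mul, Polynomial.C_add,
        Polynomial.C_pow, Polynomial.C_neg, Polynomial.C_ofNat]
      generalize Polynomial.C (κ : ℂ) = k, Polynomial.C (η : ℂ) = e, Polynomial.C Complex.I = i at *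
      linear_combination
        (-2 * e ^ 2 * (Polynomial.X ^ 2 + k ^ 2) + e ^ 4 * (i ^ 2 - 1)) * hI
  · have hs := hre μ (hreal μ hμE)
    have hμre := hhyp μ hμE
    have ht := hs
    rw [LinHam.sq_eq_sq_of_hasDoubleEigenvalues hE hdbl hμ0] at ht
    exact LinHam.encard_invariantLagrangianPlanes_eq_three hV hω_alt hω_nondeg hskew hμre
      (LinHam.toLin'_annihilated_of_eigenvalues_eq hE hs ht)
      (LinHam.sq_ne_smul_one_of_hasNonzeroNilpotentPart hnil (pow_ne_zero 2 hμre))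
  · have hs := hre μ (hreal μ hμE)
    have ht := hre ν (hreal ν hνE)
    have hne := LinHam.sq_ne_sq_of_hasSimpleEigenvalues hE hsimp
    refine LinHam.encard_invariantLagrangianPlanes_eq_four hV hω_alt hω_nondeg hskew
      (hhyp μ hμE) (hhyp ν hνE) ?_ (LinHam.toLin'_annihilated_of_eigenvalues_eq hE hs ht) ?_ ?_
    · intro h
      exact hne (by rw [hs, ht, h])
    · intro h
      exact hne (by rw [hs, LinHam.sq_eq_of_mem_eigenvalues h hνE])
    · intro h
      exact hne (by rw [ht, LinHam.sq_eq_of_mem_eigenvalues h hμE])
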